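/- Let $\mathbb K=\mathbb R$ or $\mathbb C$. For $0\le d\le 10$ let $\mathfrak Q_{10-d,d}(0,\dots,0)$ be the quotient of the free Lie algebra over $\mathbb K$ on ten generators, listed in the order $x_0,x_1,\dots,x_8,x_{10}$ and also written $y_1,\dots,y_{10}$, by the ideal generated by the ten elements $\sum_{i=1}^{10-d}[y_i,[y_i,y_j]]-\sum_{i=11-d}^{10}[y_i,[y_i,y_j]]$, $j=1,\dots,10$. Let $\mathfrak g(E_9)$ be the Kac–Moody algebra over $\mathbb K$ of type $E_9$ (the untwisted affine extension of $E_8$) with simple roots $\alpha_0,\alpha_1,\dots,\alpha_8$, where $\alpha_1,\dots,\alpha_8$ are the simple roots of $E_8$, with Chevalley generators $e_i,f_i$ and root system $\Delta(E_9)$, and let $\mathfrak g'(E_9)=[\mathfrak g(E_9),\mathfrak g(E_9)]$. Let $\theta$ be the highest root of $E_8$ and $\delta=\alpha_0+\theta$. Let $\gamma=n\delta+\beta$ be a real root of $E_9$, with $n\in\mathbb Z$ and $\beta\in\Delta(E_8)\setminus\{-\theta,\alpha_1,\dots,\alpha_8\}$, and let $0\ne e_\gamma\in\mathfrak g(E_9)_\gamma$.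 Then: 1. For $i=0,\dots,8$, neither $2\gamma-\alpha_i$ nor $\gamma-2\alpha_i$ is a root of $E_9$, and $[y,[y,z]]=0$ for all $y,z\in\{e_\gamma,f_0,f_1,\dots,f_8\}$. 2. For every $d$ with $0\le d\le 10$, the map $x_0\mapsto f_0,\ \dots,\ x_8\mapsto f_8,\ x_{10}\mapsto e_\gamma$ extends to a homomorphism of Lie algebras $\mathfrak Q_{10-d,d}(0,\dots,0)\to\mathfrak g'(E_9)$. 3. If moreover $\gamma$ is a positive root with maximal support, i.e. $\gamma=\sum_{i=0}^8k_i\alpha_i$ with all $k_i>0$, then the elements $e_\gamma,f_0,f_1,\dots,f_8$ generate $\mathfrak g'(E_9)$, and the homomorphism in 2 is an epimorphism for every $d$. -/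

import Mathlib

/-! ### Quantum minimal surface algebras -/

/-- The sign of the `i`-th generator (counted from `0`) in signature `(n - m, m)`: the first `n - m`
generators carry the sign `+1`, the last `m` the sign `-1`. -/
def qmsaSign (n m : ℕ) (i : Fin n) : ℤ :=
  if (i : ℕ) < n - m then 1 else -1

/-- The terms `∑ i, ± [x_i, [x_i, x_j]] - μ_j x_j`, `j = 1, …, n`, of the free Lie algebra. -/
noncomputable def qmsaRelation (K : Type*) [CommRing K] (n m : ℕ) (μ : Fin n → K) (j : Fin n) :
    FreeLieAlgebra K (Fin n) :=
  (∑ i : Fin n, qmsaSign n m i •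
      ⁅FreeLieAlgebra.of K i, ⁅FreeLieAlgebra.of K i, FreeLieAlgebra.of K j⁆⁆)
    - μ j • FreeLieAlgebra.of K j

/-- The ideal of the free Lie algebra that is generated by the relations. -/
noncomputable def qmsaIdeal (K : Type*) [CommRing K] (n m : ℕ) (μ : Fin n → K) :
    LieIdeal K (FreeLieAlgebra K (Fin n)) :=
  LieSubmodule.lieSpan K (FreeLieAlgebra K (Fin n)) (Set.range (qmsaRelation K n m μ))

/-- The quantum minimal surface algebra of rank `n`, signature `(n - m, m)` (for `m ≤ n`) and
spectrum `μ`. -/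
abbrev QMSA (K : Type*) [CommRing K] (n m : ℕ) (μ : Fin n → K) : Type _ :=
  FreeLieAlgebra K (Fin n) ⧸ qmsaIdeal K n m μ

/-- The generators of the quantum minimal surface algebra. -/
noncomputable def QMSA.gen (K : Type*) [CommRing K] (n m : ℕ) (μ : Fin n → K) (j : Fin n) :
    QMSA K n m μ :=
  LieSubmodule.Quotient.mk (N := qmsaIdeal K n m μ) (FreeLieAlgebra.of K j)

/-! ### Kac-Moody algebras -/

/-- A realization `(H, Π, Π^∨)` over the field `K` of an integral matrix `A`: linearly independent
simple roots in the dual of `H` and linearly independent simple coroots in `H` that are paired by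
`A`, where `dim H = 2 n - rank A`. -/
structure Realization (K : Type*) [Field K] {ι : Type*} [Fintype ι] (A : Matrix ι ι ℤ)
    (H : Type*) [AddCommGroup H] [Module K H] where
  /-- The simple roots. -/
  root : ι → Module.Dual K H
  /-- The simple coroots. -/
  coroot : ι → H
  root_coroot : ∀ i j, root j (coroot i) = (A i j : K)
  linearIndependent_root : LinearIndependent K root
  linearIndependent_coroot : LinearIndependent K coroot
  finiteDimensional : FiniteDimensional K H
  finrank_add_rank :
    Module.finrank K H + (A.map (Int.cast : ℤ → K)).rank = 2 * Fintype.card ι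

/-- The generators of a Kac-Moody algebra: the elements of the Cartan subalgebra `H` and the
elements `e_i`, `f_i`. -/
inductive KMGenerator (H ι : Type*)
  | h : H → KMGenerator H ι
  | e : ι → KMGenerator H ι
  | f : ι → KMGenerator H ι

/-- The free Lie algebra on the generators of a Kac-Moody algebra. -/
abbrev KMFree (K : Type*) [CommRing K] (H ι : Type*) : Type _ :=
  FreeLieAlgebra K (KMGenerator H ι)

namespace KMFree

variable (K : Type*) [CommRing K] {H ι : Type*}

/-- The generator of the free Lie algebra that belongs to `x : H`. -/
noncomputable def h (x : H) : KMFree K H ι := FreeLieAlgebra.of K (KMGenerator.h x)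

/-- The generator `e_i` of the free Lie algebra. -/
noncomputable def e (i : ι) : KMFree K H ι := FreeLieAlgebra.of K (KMGenerator.e i)

/-- The generator `f_i` of the free Lie algebra. -/
noncomputable def f (i : ι) : KMFree K H ι := FreeLieAlgebra.of K (KMGenerator.f i)

end KMFree

namespace Realization

variable {K : Type*} [Field K] {ι : Type*} [Fintype ι] {A : Matrix ι ι ℤ}
  {H : Type*} [AddCommGroup H] [Module K H]

open KMFree in
/-- The elements of the free Lie algebra that are set to zero in the Kac-Moody algebra. The first
two families say that `H` is embedded linearly, the last two are the Serre relations. -/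
inductive IsRelator (R : Realization K A H) : KMFree K H ι → Prop
  | add (x y : H) : IsRelator R (h K (x + y) - (h K x + h K y))
  | smul (c : K) (x : H) : IsRelator R (h K (c • x) - c • h K x)
  | hh (x y : H) : IsRelator R ⁅(h K x : KMFree K H ι), (h K y : KMFree K H ι)⁆
  | he (x : H) (i : ι) : IsRelator R (⁅(h K x : KMFree K H ι), e K i⁆ - R.root i x • e K i)
  | hf (x : H) (i : ι) : IsRelator R (⁅(h K x : KMFree K H ι), f K i⁆ + R.root i x • f K i)
  | ef_same (i : ι) : IsRelator R (⁅(e K i : KMFree K H ι), f K i⁆ - h K (R.coroot i))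
  | ef_ne (i j : ι) (hij : i ≠ j) : IsRelator R ⁅(e K i : KMFree K H ι), (f K j : KMFree K H ι)⁆
  | serre_e (i j : ι) (hij : i ≠ j) : IsRelator R
      ((LieAlgebra.ad K (KMFree K H ι) (e K i) ^ (1 - A i j).toNat) (e K j))
  | serre_f (i j : ι) (hij : i ≠ j) : IsRelator R
      ((LieAlgebra.ad K (KMFree K H ι) (f K i) ^ (1 - A i j).toNat) (f K j))

/-- The ideal generated by the defining relations. -/
noncomputable def ideal (R : Realization K A H) :
    LieIdeal K (KMFree K H ι) :=
  LieSubmodule.lieSpan K (KMFree K H ι) {x | R.IsRelator x}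

/-- The Kac-Moody algebra `𝔤(A)` of a (symmetrizable) generalized Cartan matrix `A`, with Cartan
subalgebra given by the realization. -/
abbrev KacMoody (R : Realization K A H) : Type _ :=
  KMFree K H ι ⧸ R.ideal

/-- The elements of the Cartan subalgebra in the Kac-Moody algebra. -/
noncomputable def h (R : Realization K A H) (x : H) : R.KacMoody :=
  LieSubmodule.Quotient.mk (N := R.ideal) (KMFree.h K x)

/-- The Chevalley generators `f_i`. -/
noncomputable def f (R : Realization K A H) (i : ι) : R.KacMoody :=
  LieSubmodule.Quotient.mk (N := R.ideal) (KMFree.f K i)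

/-- The derived algebra `𝔤'(A) = [𝔤(A), 𝔤(A)]`. -/
noncomputable def derived (R : Realization K A H) : LieSubalgebra K R.KacMoody :=
  LieIdeal.toLieSubalgebra K R.KacMoody
    ⁅(⊤ : LieIdeal K R.KacMoody), (⊤ : LieIdeal K R.KacMoody)⁆

/-- The linear form `∑ i, k_i α_i` on `H` with coordinates `k` in the root lattice. -/
noncomputable def weight (R : Realization K A H) (k : ι → ℤ) : Module.Dual K H :=
  ∑ i, k i • R.root i

/-- The root space `𝔤(A)_α`, for `α = ∑ i, k_i α_i`. -/
noncomputable def rootSpace (R : Realization K A H) (k : ι → ℤ) : Submodule K R.KacMoody where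
  carrier := {x | ∀ y : H, ⁅R.h y, x⁆ = R.weight k y • x}
  add_mem' := fun {a b} ha hb y => by rw [lie_add, ha y, hb y, smul_add]
  zero_mem' := fun y => by rw [lie_zero, smul_zero]
  smul_mem' := fun c x hx y => by rw [lie_smul, hx y, smul_comm]

/-- The roots `Δ(A)`, in coordinates with respect to the simple roots. -/
def roots (R : Realization K A H) : Set (ι → ℤ) :=
  {k | k ≠ 0 ∧ R.rootSpace k ≠ ⊥}

end Realization

/-- The real roots `Δ^re(A) = W · {α_1, …, α_n}`, in coordinates with respect to the simple roots:
the smallest set that contains the simple roots and is stable under the simple reflections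
`r_i(λ) = λ - ⟨λ, α_i^∨⟩ α_i`, which generate the Weyl group `W`. -/
inductive IsRealRoot {ι : Type*} [Fintype ι] [DecidableEq ι] (A : Matrix ι ι ℤ) : (ι → ℤ) → Prop
  | simple (i : ι) : IsRealRoot A (Pi.single i 1)
  | reflect (i : ι) (k : ι → ℤ) (hk : IsRealRoot A k) :
      IsRealRoot A (k - (∑ j, A i j * k j) • Pi.single i 1)

/-! ### The types `E₈` and `E₉` -/

/-- The coefficients of the highest root `θ` of `E₈` (Bourbaki labelling, as in
`CartanMatrix.E₈`). -/
def thetaE8 : Fin 8 → ℤ := ![2, 3, 4, 6, 5, 4, 3, 2]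

/-- The generalized Cartan matrix of `E₉`, the affine extension of `E₈`. The index `0` is the affine
node, which is joined to the node `8`; the indices `1, …, 8` are the nodes of `E₈`. -/
def cartanE9 : Matrix (Fin 9) (Fin 9) ℤ :=
  !![ 2,  0,  0,  0,  0,  0,  0,  0, -1;
      0,  2,  0, -1,  0,  0,  0,  0,  0;
      0,  0,  2,  0, -1,  0,  0,  0,  0;
      0, -1,  0,  2, -1,  0,  0,  0,  0;
      0,  0, -1, -1,  2, -1,  0,  0,  0;
      0,  0,  0,  0, -1,  2, -1,  0,  0;
      0,  0,  0,  0,  0, -1,  2, -1,  0;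
      0,  0,  0,  0,  0,  0, -1,  2, -1;
     -1,  0,  0,  0,  0,  0,  0, -1,  2]

/-- The root lattice of `E₈` inside that of `E₉`. -/
def embedE8 (β : Fin 8 → ℤ) : Fin 9 → ℤ := Fin.cons 0 β

/-- The null root `δ = α_0 + θ` of `E₉`. -/
def deltaE9 : Fin 9 → ℤ := Pi.single 0 1 + embedE8 thetaE8

/-!
Let `q` be the quadratic form `k ↦ k · A k` on the root lattice. Each root `k` satisfies `q k ≤ 2`:
otherwise some `k i` and `(A k) i` have the same sign and `r_i k` is a strictly smaller root, since
by the triangular decomposition the coordinates of a root have a common sign and a root supported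
on one node is simple up to sign. That `r_i` permutes the roots is the representation theory of
`sl₂`, as `e_i` and `f_i` act locally nilpotently.

A real root `γ` has `q γ = 2`. As `q` is positive semidefinite with kernel `ℤ δ`, this gives
`(A γ) i ≤ 2`, with equality only for `γ ∈ α_i + ℤ δ`. Otherwise `2γ - α_i` and `γ - 2α_i` have
`q ≥ 6`, so they are not roots, and the double brackets of `e_γ` with the `f_i` lie in root spaces
that vanish.

For generation, fix `i` and descend from `γ` to `α_i` by applying the `f_j`, through roots of norm
`2` whose `i`-th coordinate stays positive. A simple reflection lowers such a root, except at `α_i`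
and at `α_i + δ`. From the latter, `f_j f_i` leads to `δ - α_j`, where `j` is a neighbour of `i`.
-/

open Matrix

/-! ### Generation of Lie algebras -/

section Generation

variable {K L : Type*} [CommRing K] [LieRing L] [LieAlgebra K L] {G : Set L}

theorem lieSpan_le_of_le_comap_ad {S : Submodule K L} (hGS : G ⊆ S)
    (hS : ∀ x ∈ G, S ≤ S.comap (LieAlgebra.ad K L x)) :
    (LieSubalgebra.lieSpan K L G).toSubmodule ≤ S := by
  have hstable {x : L} (hx : x ∈ LieSubalgebra.lieSpan K L G) : ∀ z ∈ S, ⁅x, z⁆ ∈ S := by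
    induction hx using LieSubalgebra.lieSpan_induction with
    | mem x hx => exact hS x hx
    | zero => simp
    | add x y _ _ hx hy => exact fun z hz => add_lie x y z ▸ add_mem (hx z hz) (hy z hz)
    | smul c x _ hx => exact fun z hz => smul_lie c x z ▸ S.smul_mem c (hx z hz)
    | lie x y _ _ hx hy =>
      exact fun z hz => lie_lie x y z ▸ sub_mem (hx _ (hy z hz)) (hy _ (hx z hz))
  intro z hz
  induction hz using LieSubalgebra.lieSpan_induction with
  | mem x hx => exact hGS hx
  | zero => exact zero_mem S
  | add x y _ _ hx hy => exact add_mem hx hy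
  | smul c x _ hx => exact S.smul_mem c hx
  | lie x y hx _ _ hy => exact hstable hx y hy

theorem mem_normalizer_lieSpan {t : L} (ht : ∀ y ∈ G, ⁅t, y⁆ ∈ LieSubalgebra.lieSpan K L G) :
    t ∈ (LieSubalgebra.lieSpan K L G).normalizer := by
  rw [LieSubalgebra.mem_normalizer_iff]
  intro z hz
  induction hz using LieSubalgebra.lieSpan_induction with
  | mem y hy => exact ht y hy
  | zero => simp
  | add x y _ _ hx hy => exact lie_add t x y ▸ add_mem hx hy
  | smul c x _ hx => exact lie_smul c t x ▸ LieSubalgebra.smul_mem _ c hx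
  | lie x y hx hy hx' hy' =>
    exact leibniz_lie t x y ▸ add_mem (LieSubalgebra.lie_mem _ hx' hy)
      (LieSubalgebra.lie_mem _ hx hy')

theorem lie_mem_lieSpan_sup {T : Submodule K L}
    (hT : T ≤ (LieSubalgebra.lieSpan K L G).normalizer.toSubmodule) {a : L}
    (ha : ∀ y ∈ G, ⁅a, y⁆ ∈ T) {z : L} (hz : z ∈ LieSubalgebra.lieSpan K L G) :
    ⁅a, z⁆ ∈ (LieSubalgebra.lieSpan K L G).toSubmodule ⊔ T := by
  have hsup : (LieSubalgebra.lieSpan K L G).toSubmodule ⊔ T ≤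
      (LieSubalgebra.lieSpan K L G).normalizer.toSubmodule :=
    sup_le (LieSubalgebra.le_normalizer _) hT
  induction hz using LieSubalgebra.lieSpan_induction with
  | mem y hy => exact Submodule.mem_sup_right (ha y hy)
  | zero => simp
  | add x y _ _ hx hy => exact lie_add a x y ▸ add_mem hx hy
  | smul c x _ hx => exact lie_smul c a x ▸ Submodule.smul_mem _ c hx
  | lie x y hx hy hx' hy' =>
    rw [leibniz_lie]
    exact Submodule.mem_sup_left (add_mem
      ((LieSubalgebra.mem_normalizer_iff _ _).1 (hsup hx') y hy)
      ((LieSubalgebra.mem_normalizer_iff' _ _).1 (hsup hy') x hx))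

end Generation

/-- `IsWord x k w` says that `w` is an iterated bracket `[x_i, [x_j, … [x_l, x_m]]]` in which each
`x_i` occurs `k i` times. These right-nested brackets suffice to span the Lie subalgebra generated
by the `x_i`, and they record its grading. -/
inductive IsWord {ι L : Type*} [DecidableEq ι] [LieRing L] (x : ι → L) : (ι → ℤ) → L → Prop
  | single (i : ι) : IsWord x (Pi.single i 1) (x i)
  | cons (i : ι) (k : ι → ℤ) (w : L) (hw : IsWord x k w) :
      IsWord x (Pi.single i 1 + k) ⁅x i, w⁆

namespace IsWord

variable {ι L : Type*} [DecidableEq ι] [LieRing L] {x : ι → L}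

theorem pos {k : ι → ℤ} {w : L} (hw : IsWord x k w) : 0 < k := by
  have hpos (i : ι) : (0 : ι → ℤ) < Pi.single i 1 := by simp
  induction hw with
  | single i => exact hpos i
  | cons i _ _ _ ih => exact add_pos (hpos i) ih

theorem eq_generator_or_eq_zero {k : ι → ℤ} {w : L} (hw : IsWord x k w) {i : ι}
    (hk : ∀ j ≠ i, k j = 0) : (k i = 1 ∧ w = x i) ∨ w = 0 := by
  induction hw with
  | single j =>
    obtain rfl : j = i := by_contra fun hj => by simpa using hk j hj
    simp
  | cons j k w hw ih =>
    have hk0 : 0 ≤ k := hw.pos.le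
    obtain rfl : j = i := by
      by_contra hj
      have hkj := hk j hj
      have hkj0 := hk0 j
      simp only [Pi.add_apply, Pi.single_eq_same, Pi.zero_apply] at hkj hkj0
      omega
    rcases ih fun l hl => by simpa [hl] using hk l hl with ⟨-, rfl⟩ | rfl <;> simp

theorem lieSpan_range_le_span {K : Type*} [CommRing K] [LieAlgebra K L] :
    (LieSubalgebra.lieSpan K L (Set.range x)).toSubmodule ≤
      Submodule.span K {w | ∃ k, IsWord x k w} := by
  refine lieSpan_le_of_le_comap_ad ?_ ?_
  · rintro _ ⟨i, rfl⟩
    exact Submodule.subset_span ⟨_, single i⟩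
  · rintro _ ⟨i, rfl⟩
    exact Submodule.span_le.2 fun w ⟨k, hw⟩ => Submodule.subset_span ⟨_, cons i k w hw⟩

end IsWord

/-! ### Triangular decomposition and root spaces -/

namespace Realization

variable {K : Type*} [Field K] {ι : Type*} [Fintype ι] {A : Matrix ι ι ℤ}
  {H : Type*} [AddCommGroup H] [Module K H] (R : Realization K A H)

section Relations

/-- The Chevalley generators `e_i`. -/
noncomputable def e (i : ι) : R.KacMoody :=
  LieSubmodule.Quotient.mk (N := R.ideal) (KMFree.e K i)

/-- The projection of the free Lie algebra onto the Kac-Moody algebra. -/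
noncomputable def proj : KMFree K H ι →ₗ⁅K⁆ R.KacMoody where
  toLinearMap := R.ideal.toSubmodule.mkQ
  map_lie' := rfl

variable {R} in
theorem proj_eq_zero {z : KMFree K H ι} (hz : R.IsRelator z) : R.proj z = 0 :=
  (Submodule.Quotient.mk_eq_zero R.ideal.toSubmodule).2 (LieSubmodule.subset_lieSpan hz)

theorem proj_surjective : Function.Surjective R.proj := Submodule.mkQ_surjective _

@[simp] theorem proj_h (t : H) : R.proj (KMFree.h K t) = R.h t := rfl
@[simp] theorem proj_e (i : ι) : R.proj (KMFree.e K i) = R.e i := rfl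
@[simp] theorem proj_f (i : ι) : R.proj (KMFree.f K i) = R.f i := rfl

/-- The map `Realization.h` from the Cartan subalgebra to the Kac-Moody algebra, as a linear
map. -/
noncomputable def hLin : H →ₗ[K] R.KacMoody where
  toFun := R.h
  map_add' s t := by simpa [sub_eq_zero] using proj_eq_zero (IsRelator.add (R := R) s t)
  map_smul' c t := by simpa [sub_eq_zero] using proj_eq_zero (IsRelator.smul (R := R) c t)

@[simp] theorem hLin_apply (t : H) : R.hLin t = R.h t := rfl

theorem lie_h_h (s t : H) : ⁅R.h s, R.h t⁆ = 0 := by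
  simpa using proj_eq_zero (IsRelator.hh (R := R) s t)

theorem lie_h_e (t : H) (i : ι) : ⁅R.h t, R.e i⁆ = R.root i t • R.e i := by
  simpa [sub_eq_zero] using proj_eq_zero (IsRelator.he (R := R) t i)

theorem lie_h_f (t : H) (i : ι) : ⁅R.h t, R.f i⁆ = -(R.root i t • R.f i) := by
  simpa [add_eq_zero_iff_eq_neg] using proj_eq_zero (IsRelator.hf (R := R) t i)

theorem lie_e_h (t : H) (i : ι) : ⁅R.e i, R.h t⁆ = -(R.root i t • R.e i) := by
  rw [← lie_skew, lie_h_e]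

theorem lie_f_h (t : H) (i : ι) : ⁅R.f i, R.h t⁆ = R.root i t • R.f i := by
  rw [← lie_skew, lie_h_f, neg_neg]

theorem lie_e_f_same (i : ι) : ⁅R.e i, R.f i⁆ = R.h (R.coroot i) := by
  simpa [sub_eq_zero] using proj_eq_zero (IsRelator.ef_same (R := R) i)

theorem lie_f_e_same (i : ι) : ⁅R.f i, R.e i⁆ = -R.h (R.coroot i) := by
  rw [← lie_skew, lie_e_f_same]

theorem lie_e_f_ne {i j : ι} (hij : i ≠ j) : ⁅R.e i, R.f j⁆ = 0 := by
  simpa using proj_eq_zero (IsRelator.ef_ne (R := R) i j hij)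

theorem proj_ad_pow (x y : KMFree K H ι) (n : ℕ) :
    R.proj ((LieAlgebra.ad K (KMFree K H ι) x ^ n) y) =
      (LieAlgebra.ad K R.KacMoody (R.proj x) ^ n) (R.proj y) := by
  induction n with
  | zero => simp
  | succ n ih => simp [pow_succ', ih]

theorem serre_e {i j : ι} (hij : i ≠ j) :
    (LieAlgebra.ad K R.KacMoody (R.e i) ^ (1 - A i j).toNat) (R.e j) = 0 := by
  simpa [proj_ad_pow] using proj_eq_zero (IsRelator.serre_e (R := R) i j hij)

theorem serre_f {i j : ι} (hij : i ≠ j) :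
    (LieAlgebra.ad K R.KacMoody (R.f i) ^ (1 - A i j).toNat) (R.f j) = 0 := by
  simpa [proj_ad_pow] using proj_eq_zero (IsRelator.serre_f (R := R) i j hij)

theorem lieSpan_generators :
    LieSubalgebra.lieSpan K R.KacMoody (Set.range R.h ∪ Set.range R.e ∪ Set.range R.f) = ⊤ := by
  set S := LieSubalgebra.lieSpan K R.KacMoody (Set.range R.h ∪ Set.range R.e ∪ Set.range R.f)
  let g : KMGenerator H ι → S := fun
    | .h t => ⟨R.h t, LieSubalgebra.subset_lieSpan (.inl (.inl ⟨t, rfl⟩))⟩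
    | .e i => ⟨R.e i, LieSubalgebra.subset_lieSpan (.inl (.inr ⟨i, rfl⟩))⟩
    | .f i => ⟨R.f i, LieSubalgebra.subset_lieSpan (.inr ⟨i, rfl⟩)⟩
  have hg : S.incl.comp (FreeLieAlgebra.lift K g) = R.proj := by
    refine FreeLieAlgebra.hom_ext fun z => ?_
    rcases z with t | i | i <;> exact congrArg S.incl (FreeLieAlgebra.lift_of_apply g _)
  refine eq_top_iff.2 fun z _ => ?_
  obtain ⟨y, rfl⟩ := R.proj_surjective z
  exact hg ▸ (FreeLieAlgebra.lift K g y).2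

variable {R} in
theorem submodule_eq_top {S : Submodule K R.KacMoody} (hh : ∀ t, R.h t ∈ S) (he : ∀ i, R.e i ∈ S)
    (hf : ∀ i, R.f i ∈ S) (hh' : ∀ t, S ≤ S.comap (LieAlgebra.ad K R.KacMoody (R.h t)))
    (he' : ∀ i, S ≤ S.comap (LieAlgebra.ad K R.KacMoody (R.e i)))
    (hf' : ∀ i, S ≤ S.comap (LieAlgebra.ad K R.KacMoody (R.f i))) : S = ⊤ := by
  rw [eq_top_iff, ← LieSubalgebra.top_toSubmodule, ← R.lieSpan_generators]
  refine lieSpan_le_of_le_comap_ad ?_ ?_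
  · rintro _ ((⟨t, rfl⟩ | ⟨i, rfl⟩) | ⟨i, rfl⟩)
    exacts [hh t, he i, hf i]
  · rintro _ ((⟨t, rfl⟩ | ⟨i, rfl⟩) | ⟨i, rfl⟩)
    exacts [hh' t, he' i, hf' i]

end Relations

section Triangular

theorem lie_e_f_mem_range_hLin (i j : ι) : ⁅R.e i, R.f j⁆ ∈ LinearMap.range R.hLin := by
  obtain rfl | hij := eq_or_ne i j
  · exact ⟨R.coroot i, (R.lie_e_f_same i).symm⟩
  · exact R.lie_e_f_ne hij ▸ zero_mem _

theorem range_hLin_le_normalizer_lieSpan_e : LinearMap.range R.hLin ≤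
    (LieSubalgebra.lieSpan K R.KacMoody (Set.range R.e)).normalizer.toSubmodule := by
  rintro _ ⟨t, rfl⟩
  refine mem_normalizer_lieSpan ?_
  rintro _ ⟨i, rfl⟩
  exact R.lie_h_e t i ▸ LieSubalgebra.smul_mem _ _ (LieSubalgebra.subset_lieSpan ⟨i, rfl⟩)

theorem range_hLin_le_normalizer_lieSpan_f : LinearMap.range R.hLin ≤
    (LieSubalgebra.lieSpan K R.KacMoody (Set.range R.f)).normalizer.toSubmodule := by
  rintro _ ⟨t, rfl⟩
  refine mem_normalizer_lieSpan ?_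
  rintro _ ⟨i, rfl⟩
  exact R.lie_h_f t i ▸
    neg_mem (LieSubalgebra.smul_mem _ _ (LieSubalgebra.subset_lieSpan ⟨i, rfl⟩))

theorem lie_e_mem_of_mem_lieSpan_f (i : ι) {z : R.KacMoody}
    (hz : z ∈ LieSubalgebra.lieSpan K R.KacMoody (Set.range R.f)) :
    ⁅R.e i, z⁆ ∈ (LieSubalgebra.lieSpan K R.KacMoody (Set.range R.f)).toSubmodule ⊔
      LinearMap.range R.hLin := by
  refine lie_mem_lieSpan_sup R.range_hLin_le_normalizer_lieSpan_f ?_ hz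
  rintro _ ⟨j, rfl⟩
  exact R.lie_e_f_mem_range_hLin i j

theorem lie_f_mem_of_mem_lieSpan_e (i : ι) {z : R.KacMoody}
    (hz : z ∈ LieSubalgebra.lieSpan K R.KacMoody (Set.range R.e)) :
    ⁅R.f i, z⁆ ∈ (LieSubalgebra.lieSpan K R.KacMoody (Set.range R.e)).toSubmodule ⊔
      LinearMap.range R.hLin := by
  refine lie_mem_lieSpan_sup R.range_hLin_le_normalizer_lieSpan_e ?_ hz
  rintro _ ⟨j, rfl⟩
  exact lie_skew (R.f i) (R.e j) ▸ neg_mem (R.lie_e_f_mem_range_hLin j i)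

theorem triangular_decomposition :
    (LieSubalgebra.lieSpan K R.KacMoody (Set.range R.e)).toSubmodule ⊔ LinearMap.range R.hLin ⊔
      (LieSubalgebra.lieSpan K R.KacMoody (Set.range R.f)).toSubmodule = ⊤ := by
  set N := LieSubalgebra.lieSpan K R.KacMoody (Set.range R.e)
  set N' := LieSubalgebra.lieSpan K R.KacMoody (Set.range R.f)
  set S := N.toSubmodule ⊔ LinearMap.range R.hLin ⊔ N'.toSubmodule
  have hN : N.toSubmodule ≤ S := le_sup_left.trans le_sup_left
  have hT : LinearMap.range R.hLin ≤ S := le_sup_right.trans le_sup_left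
  have hN' : N'.toSubmodule ≤ S := le_sup_right
  have he (i : ι) : R.e i ∈ N := LieSubalgebra.subset_lieSpan ⟨i, rfl⟩
  have hf (i : ι) : R.f i ∈ N' := LieSubalgebra.subset_lieSpan ⟨i, rfl⟩
  refine submodule_eq_top (fun t => hT ⟨t, rfl⟩) (fun i => hN (he i)) (fun i => hN' (hf i))
    (fun t => ?_) (fun i => ?_) (fun i => ?_) <;> refine sup_le (sup_le ?_ ?_) ?_
  · exact fun z hz => hN ((N.mem_normalizer_iff _).1
      (R.range_hLin_le_normalizer_lieSpan_e ⟨t, rfl⟩) z hz)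
  · rintro _ ⟨s, rfl⟩
    simp [lie_h_h]
  · exact fun z hz => hN' ((N'.mem_normalizer_iff _).1
      (R.range_hLin_le_normalizer_lieSpan_f ⟨t, rfl⟩) z hz)
  · exact fun z hz => hN (N.lie_mem (he i) hz)
  · rintro _ ⟨t, rfl⟩
    simpa [lie_e_h] using hN (N.smul_mem _ (he i))
  · exact fun z hz => sup_le hN' hT (R.lie_e_mem_of_mem_lieSpan_f i hz)
  · exact fun z hz => sup_le hN hT (R.lie_f_mem_of_mem_lieSpan_e i hz)
  · rintro _ ⟨t, rfl⟩
    simpa [lie_f_h] using hN' (N'.smul_mem _ (hf i))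
  · exact fun z hz => hN' (N'.lie_mem (hf i) hz)

theorem derived_le_lieSpan :
    R.derived ≤ LieSubalgebra.lieSpan K R.KacMoody (Set.range R.e ∪ Set.range R.f) := by
  set S := LieSubalgebra.lieSpan K R.KacMoody (Set.range R.e ∪ Set.range R.f)
  have hnormalizer (t : H) : R.h t ∈ S.normalizer := by
    refine mem_normalizer_lieSpan ?_
    rintro _ (⟨i, rfl⟩ | ⟨i, rfl⟩)
    · exact R.lie_h_e t i ▸ S.smul_mem _ (LieSubalgebra.subset_lieSpan (.inl ⟨i, rfl⟩))
    · exact R.lie_h_f t i ▸ neg_mem (S.smul_mem _ (LieSubalgebra.subset_lieSpan (.inr ⟨i, rfl⟩)))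
  have htop : LinearMap.range R.hLin ⊔ S.toSubmodule = ⊤ := by
    rw [eq_top_iff, ← R.triangular_decomposition]
    exact sup_le (sup_le (le_sup_of_le_right (LieSubalgebra.lieSpan_mono Set.subset_union_left))
      le_sup_left) (le_sup_of_le_right (LieSubalgebra.lieSpan_mono Set.subset_union_right))
  have hdecomp (x : R.KacMoody) : ∃ t, ∃ s ∈ S, R.h t + s = x := by
    obtain ⟨_, ⟨t, rfl⟩, s, hs, h⟩ := Submodule.mem_sup.1 (htop.ge (Submodule.mem_top (x := x)))
    exact ⟨t, s, hs, h⟩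
  have hlie : (⁅(⊤ : LieIdeal K R.KacMoody), (⊤ : LieIdeal K R.KacMoody)⁆ :
      LieIdeal K R.KacMoody).toSubmodule ≤ S.toSubmodule := by
    rw [LieSubmodule.lieIdeal_oper_eq_linear_span', Submodule.span_le]
    rintro _ ⟨x, -, y, -, rfl⟩
    obtain ⟨t, s, hs, rfl⟩ := hdecomp x
    obtain ⟨t', s', hs', rfl⟩ := hdecomp y
    rw [add_lie, lie_add, lie_add, lie_h_h, zero_add]
    exact add_mem ((S.mem_normalizer_iff _).1 (hnormalizer t) s' hs')
      (add_mem ((S.mem_normalizer_iff' _).1 (hnormalizer t') s hs) (S.lie_mem hs hs'))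
  exact hlie

end Triangular

section RootSpaces

variable {R} in
theorem mem_rootSpace {k : ι → ℤ} {x : R.KacMoody} :
    x ∈ R.rootSpace k ↔ ∀ t, ⁅R.h t, x⁆ = R.weight k t • x := Iff.rfl

@[simp] theorem weight_zero : R.weight 0 = 0 := by
  simp [weight]

theorem weight_add (k l : ι → ℤ) : R.weight (k + l) = R.weight k + R.weight l := by
  simp [weight, add_smul, Finset.sum_add_distrib]

theorem weight_neg (k : ι → ℤ) : R.weight (-k) = -R.weight k := by
  simp [weight]

theorem weight_single [DecidableEq ι] (i : ι) : R.weight (Pi.single i 1) = R.root i := by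
  simp [weight, Pi.single_apply]

theorem weight_coroot (k : ι → ℤ) (i : ι) :
    R.weight k (R.coroot i) = (((A *ᵥ k) i : ℤ) : K) := by
  simp [weight, R.root_coroot, Matrix.mulVec, dotProduct, mul_comm]

theorem weight_injective [CharZero K] : Function.Injective R.weight := by
  refine (injective_iff_map_eq_zero (AddMonoidHom.mk' R.weight R.weight_add)).2 fun k hk => ?_
  have hsum : ∑ i, (k i : K) • R.root i = 0 := by
    exact (Finset.sum_congr rfl fun i _ => Int.cast_smul_eq_zsmul K (k i) (R.root i)).trans hk
  ext i
  exact_mod_cast Fintype.linearIndependent_iff.1 R.linearIndependent_root _ hsum i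

theorem iSupIndep_rootSpace [CharZero K] : iSupIndep R.rootSpace := by
  have hcomm (s t : H) : Commute (LieAlgebra.ad K R.KacMoody (R.h s))
      (LieAlgebra.ad K R.KacMoody (R.h t)) := by
    refine LinearMap.ext fun x => ?_
    simp [leibniz_lie (R.h s), lie_h_h]
  have hindep := Module.End.independent_iInf_maxGenEigenspace_of_forall_mapsTo
    (fun t => LieAlgebra.ad K R.KacMoody (R.h t))
    (fun s t => Module.End.mapsTo_maxGenEigenspace_of_comm (hcomm t s))
  have hinj : Function.Injective fun (k : ι → ℤ) t => R.weight k t := fun k l hkl =>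
    R.weight_injective (LinearMap.ext (congrFun hkl))
  refine (hindep.comp hinj).mono fun k x hx => (Submodule.mem_iInf _).2 fun t => ?_
  exact Module.End.mem_maxGenEigenspace _ _ _ |>.2 ⟨1, by simp [hx t]⟩

variable {R} in
theorem lie_mem_rootSpace {k l : ι → ℤ} {x y : R.KacMoody} (hx : x ∈ R.rootSpace k)
    (hy : y ∈ R.rootSpace l) : ⁅x, y⁆ ∈ R.rootSpace (k + l) := by
  intro t
  rw [leibniz_lie, hx t, hy t, weight_add, smul_lie, lie_smul, LinearMap.add_apply, add_smul]

theorem h_mem_rootSpace (t : H) : R.h t ∈ R.rootSpace 0 := by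
  simp [mem_rootSpace, lie_h_h]

variable {R} in
theorem mem_derived_of_mem_rootSpace [CharZero K] {k : ι → ℤ} (hk : k ≠ 0) {x : R.KacMoody}
    (hx : x ∈ R.rootSpace k) : x ∈ R.derived := by
  obtain ⟨t, ht⟩ : ∃ t, R.weight k t ≠ 0 := by
    by_contra! h
    exact hk (R.weight_injective (by simpa using LinearMap.ext h))
  rw [← inv_smul_smul₀ ht x, ← hx t]
  exact R.derived.smul_mem _
    (LieSubmodule.lie_mem_lie (LieSubmodule.mem_top _) (LieSubmodule.mem_top _))

variable [DecidableEq ι]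

theorem e_mem_rootSpace (i : ι) : R.e i ∈ R.rootSpace (Pi.single i 1) := fun t => by
  rw [lie_h_e, weight_single]

theorem f_mem_rootSpace (i : ι) : R.f i ∈ R.rootSpace (-Pi.single i 1) := fun t => by
  rw [lie_h_f, weight_neg, weight_single, LinearMap.neg_apply, neg_smul]

variable {R} in
theorem isWord_e_mem_rootSpace {k : ι → ℤ} {w : R.KacMoody} (hw : IsWord R.e k w) :
    w ∈ R.rootSpace k := by
  induction hw with
  | single i => exact R.e_mem_rootSpace i
  | cons i k w _ ih => exact lie_mem_rootSpace (R.e_mem_rootSpace i) ih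

variable {R} in
theorem isWord_f_mem_rootSpace {k : ι → ℤ} {w : R.KacMoody} (hw : IsWord R.f k w) :
    w ∈ R.rootSpace (-k) := by
  induction hw with
  | single i => exact R.f_mem_rootSpace i
  | cons i k w _ ih => exact neg_add (Pi.single i 1) k ▸ lie_mem_rootSpace (R.f_mem_rootSpace i) ih

theorem rootSpace_eq_span [CharZero K] (k : ι → ℤ) :
    R.rootSpace k = Submodule.span K
      {w | IsWord R.e k w ∨ IsWord R.f (-k) w ∨ k = 0 ∧ w ∈ Set.range R.h} := by
  set W : (ι → ℤ) → Submodule K R.KacMoody := fun k => Submodule.span K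
    {w | IsWord R.e k w ∨ IsWord R.f (-k) w ∨ k = 0 ∧ w ∈ Set.range R.h}
  have hle : W ≤ R.rootSpace := by
    refine fun k => Submodule.span_le.2 ?_
    rintro w (hw | hw | ⟨rfl, t, rfl⟩)
    · exact isWord_e_mem_rootSpace hw
    · exact neg_neg k ▸ isWord_f_mem_rootSpace hw
    · exact R.h_mem_rootSpace t
  have hmem {k w} (hw : IsWord R.e k w ∨ IsWord R.f (-k) w ∨ k = 0 ∧ w ∈ Set.range R.h) :
      w ∈ iSup W := le_iSup W k (Submodule.subset_span hw)
  have htop : iSup W = ⊤ := by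
    rw [eq_top_iff, ← R.triangular_decomposition]
    refine sup_le (sup_le ?_ ?_) ?_
    · exact IsWord.lieSpan_range_le_span.trans
        (Submodule.span_le.2 fun w ⟨k, hw⟩ => hmem (.inl hw))
    · rintro _ ⟨t, rfl⟩
      exact hmem (.inr (.inr ⟨rfl, t, rfl⟩))
    · exact IsWord.lieSpan_range_le_span.trans
        (Submodule.span_le.2 fun w ⟨k, hw⟩ => hmem (k := -k) (.inr (.inl (by rwa [neg_neg]))))
  exact (congrFun ((R.iSupIndep_rootSpace.le_iff_eq_of_iSup_eq_top htop).1 hle) k).symm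

variable {R}

theorem exists_isWord_of_mem_roots [CharZero K] {k : ι → ℤ} (hk : k ∈ R.roots) :
    ∃ w ≠ 0, IsWord R.e k w ∨ IsWord R.f (-k) w := by
  by_contra! h
  refine hk.2 (R.rootSpace_eq_span k ▸ Submodule.span_eq_bot.2 ?_)
  rintro w (hw | hw | ⟨hk0, -⟩)
  · exact of_not_not fun hw0 => (h w hw0).1 hw
  · exact of_not_not fun hw0 => (h w hw0).2 hw
  · exact absurd hk0 hk.1

theorem rootSpace_single_le [CharZero K] (i : ι) :
    R.rootSpace (Pi.single i 1) ≤ Submodule.span K {R.e i} := by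
  rw [rootSpace_eq_span, Submodule.span_le]
  rintro w (hw | hw | ⟨h0, -⟩)
  · rcases hw.eq_generator_or_eq_zero (i := i) (by simp +contextual) with ⟨-, rfl⟩ | rfl
    exacts [Submodule.mem_span_singleton_self _, zero_mem _]
  · exact absurd (hw.pos.le i) (by simp)
  · simp at h0

end RootSpaces

section Roots

variable {R} [CharZero K]

theorem nonneg_or_nonpos_of_mem_roots {k : ι → ℤ} (hk : k ∈ R.roots) : 0 ≤ k ∨ k ≤ 0 := by
  classical
  obtain ⟨w, -, hw | hw⟩ := exists_isWord_of_mem_roots hk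
  · exact .inl hw.pos.le
  · exact .inr (neg_nonneg.1 hw.pos.le)

theorem abs_le_one_of_mem_roots {k : ι → ℤ} (hk : k ∈ R.roots) {i : ι} (hki : ∀ j ≠ i, k j = 0) :
    |k i| ≤ 1 := by
  classical
  obtain ⟨w, hw0, hw | hw⟩ := exists_isWord_of_mem_roots hk
  · simp [((hw.eq_generator_or_eq_zero hki).resolve_right hw0).1]
  · have h := (hw.eq_generator_or_eq_zero (i := i) (by simpa using hki)).resolve_right hw0
    rw [← abs_neg, show -k i = 1 from h.1, abs_one]

theorem insert_range_f_subset_derived {k : ι → ℤ} (hk : k ≠ 0) {x : R.KacMoody}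
    (hx : x ∈ R.rootSpace k) : insert x (Set.range R.f) ⊆ (R.derived : Set R.KacMoody) := by
  classical
  rintro _ (rfl | ⟨i, rfl⟩)
  · exact mem_derived_of_mem_rootSpace hk hx
  · exact mem_derived_of_mem_rootSpace (by simp) (R.f_mem_rootSpace i)

end Roots

end Realization

/-! ### Representations of `sl₂` and root strings -/

section Sl2

open LieModule

variable {K L M : Type*} [CommRing K] [LieRing L] [LieAlgebra K L] [AddCommGroup M] [Module K M]
  [LieRingModule L M] [LieModule K L M] {h e f : L}

theorem lie_pow_succ_toEnd_of_isSl2Triple (t : IsSl2Triple h e f) {x : M} {μ : K}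
    (hx : ⁅h, x⁆ = μ • x) (n : ℕ) :
    ⁅e, (toEnd K L M f ^ (n + 1)) x⁆ =
      (toEnd K L M f ^ (n + 1)) ⁅e, x⁆ + ((n + 1) * (μ - n)) • (toEnd K L M f ^ n) x := by
  have hweight (n : ℕ) :
      ⁅h, (toEnd K L M f ^ n) x⁆ = (μ - 2 * n) • (toEnd K L M f ^ n) x := by
    have := t.symm.lie_h_pow_toEnd_e (R := K) (m := x) (μ := -μ) (by simp [hx]) n
    rw [neg_lie, neg_eq_iff_eq_neg, ← neg_smul] at this
    rw [this]
    ring_nf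
  induction n with
  | zero => simp [leibniz_lie e, t.lie_e_f, hx, add_comm]
  | succ n ih =>
    rw [← IsSl2Triple.lie_e_pow_toEnd_e, leibniz_lie e, t.lie_e_f, hweight, ih, lie_add, lie_smul,
      IsSl2Triple.lie_e_pow_toEnd_e, IsSl2Triple.lie_e_pow_toEnd_e]
    push_cast
    module

theorem pow_toEnd_ne_zero_of_isSl2Triple [IsDomain K] [CharZero K] [Module.IsTorsionFree K M]
    (t : IsSl2Triple h e f) {n m : ℕ} {x : M} (hx0 : x ≠ 0) (hx : ⁅h, x⁆ = (m : K) • x)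
    (hex : (toEnd K L M e ^ n) x = 0) : (toEnd K L M f ^ m) x ≠ 0 := by
  induction n generalizing m x with
  | zero => exact absurd hex hx0
  | succ n ih =>
    intro hfx
    have hfex : (toEnd K L M f ^ (m + 2)) ⁅e, x⁆ = 0 := by
      have := lie_pow_succ_toEnd_of_isSl2Triple t hx m
      rw [sub_self, mul_zero, zero_smul, add_zero, ← IsSl2Triple.lie_e_pow_toEnd_e, hfx, lie_zero,
        lie_zero] at this
      rw [← IsSl2Triple.lie_e_pow_toEnd_e, ← this, lie_zero]
    have hhex : ⁅h, ⁅e, x⁆⁆ = ((m + 2 : ℕ) : K) • ⁅e, x⁆ := by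
      simpa using t.lie_h_pow_toEnd_e hx 1
    have hex0 : ⁅e, x⁆ = 0 := of_not_not fun hne =>
      ih hne hhex (by simpa [pow_succ] using hex) hfex
    exact (IsSl2Triple.HasPrimitiveVectorWith.mk (t := t) hx0 hx hex0).pow_toEnd_f_ne_zero_of_eq_nat
      rfl le_rfl hfx

end Sl2

/-- The simple reflection `r_i(k) = k - ⟨k, α_i^∨⟩ α_i` of the root lattice, in coordinates with
respect to the simple roots. -/
def simpleReflection {ι : Type*} [Fintype ι] [DecidableEq ι] (A : Matrix ι ι ℤ) (i : ι)
    (k : ι → ℤ) : ι → ℤ :=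
  k - (A *ᵥ k) i • Pi.single i 1

section SimpleReflection

variable {ι : Type*} [Fintype ι] [DecidableEq ι] (A : Matrix ι ι ℤ) (i : ι) (k : ι → ℤ)

@[simp] theorem simpleReflection_apply_self : simpleReflection A i k i = k i - (A *ᵥ k) i := by
  simp [simpleReflection]

theorem simpleReflection_apply_of_ne {j : ι} (hj : j ≠ i) : simpleReflection A i k j = k j := by
  simp [simpleReflection, hj]

end SimpleReflection

namespace Realization

variable {K : Type*} [Field K] {ι : Type*} [Fintype ι] {A : Matrix ι ι ℤ}
  {H : Type*} [AddCommGroup H] [Module K H] (R : Realization K A H)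

section LocalNilpotency

theorem engel_e (i : ι) : LieSubalgebra.engel K (R.e i) = ⊤ := by
  rw [eq_top_iff, ← R.lieSpan_generators, LieSubalgebra.lieSpan_le]
  rintro _ ((⟨t, rfl⟩ | ⟨j, rfl⟩) | ⟨j, rfl⟩) <;>
    rw [SetLike.mem_coe, LieSubalgebra.mem_engel_iff]
  · exact ⟨2, by simp [pow_two, lie_e_h]⟩
  · obtain rfl | hij := eq_or_ne i j
    exacts [⟨1, by simp⟩, ⟨_, R.serre_e hij⟩]
  · obtain rfl | hij := eq_or_ne i j
    exacts [⟨3, by simp [pow_succ, lie_e_f_same, lie_e_h]⟩, ⟨1, by simp [R.lie_e_f_ne hij]⟩]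

theorem engel_f (i : ι) : LieSubalgebra.engel K (R.f i) = ⊤ := by
  rw [eq_top_iff, ← R.lieSpan_generators, LieSubalgebra.lieSpan_le]
  rintro _ ((⟨t, rfl⟩ | ⟨j, rfl⟩) | ⟨j, rfl⟩) <;>
    rw [SetLike.mem_coe, LieSubalgebra.mem_engel_iff]
  · exact ⟨2, by simp [pow_two, lie_f_h]⟩
  · obtain rfl | hij := eq_or_ne j i
    · exact ⟨3, by simp [pow_succ, lie_f_e_same, lie_f_h]⟩
    · exact ⟨1, by rw [pow_one, LieAlgebra.ad_apply, ← lie_skew, R.lie_e_f_ne hij, neg_zero]⟩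
  · obtain rfl | hij := eq_or_ne i j
    exacts [⟨1, by simp⟩, ⟨_, R.serre_f hij⟩]

theorem exists_ad_e_pow_eq_zero (i : ι) (x : R.KacMoody) :
    ∃ n : ℕ, (LieAlgebra.ad K R.KacMoody (R.e i) ^ n) x = 0 := by
  simpa only [LieSubalgebra.mem_engel_iff] using (R.engel_e i).ge (LieSubalgebra.mem_top x)

theorem exists_ad_f_pow_eq_zero (i : ι) (x : R.KacMoody) :
    ∃ n : ℕ, (LieAlgebra.ad K R.KacMoody (R.f i) ^ n) x = 0 := by
  simpa only [LieSubalgebra.mem_engel_iff] using (R.engel_f i).ge (LieSubalgebra.mem_top x)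

end LocalNilpotency

section Strings

variable {R} {i : ι} {k : ι → ℤ} {x : R.KacMoody}

theorem lie_h_coroot (hx : x ∈ R.rootSpace k) (i : ι) :
    ⁅R.h (R.coroot i), x⁆ = (((A *ᵥ k) i : ℤ) : K) • x := by
  rw [hx, weight_coroot]

theorem isSl2Triple [CharZero K] (hA : A i i = 2) (hx : x ∈ R.rootSpace k) (hx0 : x ≠ 0)
    (hk : (A *ᵥ k) i ≠ 0) : IsSl2Triple (R.h (R.coroot i)) (R.e i) (R.f i) where
  h_ne_zero h0 := by
    have := lie_h_coroot hx i
    rw [h0, zero_lie] at this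
    exact smul_ne_zero (Int.cast_ne_zero.2 hk) hx0 this.symm
  lie_e_f := R.lie_e_f_same i
  lie_h_e_nsmul := by
    rw [lie_h_e, R.root_coroot, hA, Int.cast_ofNat, ofNat_smul_eq_nsmul]
  lie_h_f_nsmul := by
    rw [lie_h_f, R.root_coroot, hA, Int.cast_ofNat, ofNat_smul_eq_nsmul]

theorem ad_f_pow_ne_zero [CharZero K] (hA : A i i = 2) (hx : x ∈ R.rootSpace k) (hx0 : x ≠ 0)
    {m : ℕ} (hm : (A *ᵥ k) i = m) : (LieAlgebra.ad K R.KacMoody (R.f i) ^ m) x ≠ 0 := by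
  obtain rfl | hm0 := eq_or_ne m 0
  · exact hx0
  obtain ⟨n, hn⟩ := R.exists_ad_e_pow_eq_zero i x
  have t := isSl2Triple hA hx hx0 (hm ▸ mod_cast hm0)
  exact pow_toEnd_ne_zero_of_isSl2Triple t hx0 (by simp [lie_h_coroot hx, hm]) hn

theorem ad_e_pow_ne_zero [CharZero K] (hA : A i i = 2) (hx : x ∈ R.rootSpace k) (hx0 : x ≠ 0)
    {m : ℕ} (hm : (A *ᵥ k) i = -m) : (LieAlgebra.ad K R.KacMoody (R.e i) ^ m) x ≠ 0 := by
  obtain rfl | hm0 := eq_or_ne m 0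
  · exact hx0
  obtain ⟨n, hn⟩ := R.exists_ad_f_pow_eq_zero i x
  have t := isSl2Triple hA hx hx0 (hm ▸ neg_ne_zero.2 (mod_cast hm0))
  exact pow_toEnd_ne_zero_of_isSl2Triple t.symm hx0 (by simp [lie_h_coroot hx, hm]) hn

theorem lie_f_ne_zero [CharZero K] (hA : A i i = 2) (hx : x ∈ R.rootSpace k) (hx0 : x ≠ 0)
    (hk : 0 < (A *ᵥ k) i) : ⁅R.f i, x⁆ ≠ 0 := by
  obtain ⟨m, hm⟩ := Int.eq_succ_of_zero_lt hk
  intro h0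
  exact ad_f_pow_ne_zero hA hx hx0 hm (by simp [pow_succ, h0])

theorem lie_e_ne_zero [CharZero K] (hA : A i i = 2) (hx : x ∈ R.rootSpace k) (hx0 : x ≠ 0)
    (hk : (A *ᵥ k) i < 0) : ⁅R.e i, x⁆ ≠ 0 := by
  obtain ⟨m, hm⟩ := Int.eq_succ_of_zero_lt (neg_pos.2 hk)
  intro h0
  exact ad_e_pow_ne_zero hA hx hx0 (neg_eq_iff_eq_neg.1 hm) (by simp [pow_succ, h0])

theorem lie_f_ne_zero_of_lie_e_ne_zero [CharZero K] (hA : A i i = 2) (hx : x ∈ R.rootSpace k)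
    (hk : (A *ᵥ k) i = 0) (hex : ⁅R.e i, x⁆ ≠ 0) : ⁅R.f i, x⁆ ≠ 0 := by
  classical
  intro hfx
  have hex' : ⁅R.e i, x⁆ ∈ R.rootSpace (Pi.single i 1 + k) :=
    lie_mem_rootSpace (R.e_mem_rootSpace i) hx
  refine lie_f_ne_zero hA hex' hex (by simp [mulVec_add, hA, hk]) ?_
  rw [leibniz_lie, hfx, lie_zero, add_zero, lie_f_e_same, neg_lie, lie_h_coroot hx, hk]
  simp

theorem ad_pow_mem_rootSpace {l : ι → ℤ} {y : R.KacMoody} (hy : y ∈ R.rootSpace l)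
    (hx : x ∈ R.rootSpace k) (n : ℕ) :
    (LieAlgebra.ad K R.KacMoody y ^ n) x ∈ R.rootSpace (k + n • l) := by
  induction n with
  | zero => simpa using hx
  | succ n ih =>
    rw [pow_succ', Module.End.mul_apply, succ_nsmul', add_left_comm]
    exact lie_mem_rootSpace hy ih

variable [DecidableEq ι]

theorem ad_f_pow_mem_rootSpace_simpleReflection (hx : x ∈ R.rootSpace k) {m : ℕ}
    (hm : (A *ᵥ k) i = m) :
    (LieAlgebra.ad K R.KacMoody (R.f i) ^ m) x ∈ R.rootSpace (simpleReflection A i k) := by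
  have hrefl : simpleReflection A i k = k + m • -Pi.single i 1 := by
    rw [simpleReflection, hm]
    module
  exact hrefl ▸ ad_pow_mem_rootSpace (R.f_mem_rootSpace i) hx m

theorem ad_e_pow_mem_rootSpace_simpleReflection (hx : x ∈ R.rootSpace k) {m : ℕ}
    (hm : (A *ᵥ k) i = -m) :
    (LieAlgebra.ad K R.KacMoody (R.e i) ^ m) x ∈ R.rootSpace (simpleReflection A i k) := by
  have hrefl : simpleReflection A i k = k + m • Pi.single i 1 := by
    rw [simpleReflection, hm]
    module
  exact hrefl ▸ ad_pow_mem_rootSpace (R.e_mem_rootSpace i) hx m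

theorem simpleReflection_mem_roots [CharZero K] (hA : A i i = 2) (hk : k ∈ R.roots) :
    simpleReflection A i k ∈ R.roots := by
  obtain ⟨x, hx, hx0⟩ := (Submodule.ne_bot_iff _).1 hk.2
  refine ⟨fun h0 => hk.1 ?_, (Submodule.ne_bot_iff _).2 ?_⟩
  · have hki : k = (A *ᵥ k) i • Pi.single i 1 := sub_eq_zero.1 h0
    have hAk := congrArg (fun l => (A *ᵥ l) i) hki
    simp only [mulVec_smul, mulVec_single_one, Pi.smul_apply, col_apply, hA, smul_eq_mul] at hAk
    rw [hki, show (A *ᵥ k) i = 0 by omega, zero_smul]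
  · obtain ⟨m, hm | hm⟩ := Int.eq_nat_or_neg ((A *ᵥ k) i)
    · exact ⟨_, ad_f_pow_mem_rootSpace_simpleReflection hx hm, ad_f_pow_ne_zero hA hx hx0 hm⟩
    · exact ⟨_, ad_e_pow_mem_rootSpace_simpleReflection hx hm, ad_e_pow_ne_zero hA hx hx0 hm⟩

end Strings

end Realization

/-! ### The quadratic form of a symmetric Cartan matrix -/

section QuadraticForm

variable {ι : Type*} [Fintype ι] [DecidableEq ι] {A : Matrix ι ι ℤ}

theorem toQuadraticForm'_apply_eq_dotProduct (k : ι → ℤ) :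
    A.toQuadraticForm' k = k ⬝ᵥ A *ᵥ k :=
  toLinearMap₂'_apply' A k k

theorem toQuadraticForm'_sub_smul_single (hA : A.IsSymm) {i : ι} (hi : A i i = 2) (k : ι → ℤ)
    (c : ℤ) : A.toQuadraticForm' (k - c • Pi.single i 1) =
      A.toQuadraticForm' k - 2 * c * (A *ᵥ k) i + 2 * c ^ 2 := by
  have hcol : k ⬝ᵥ A.col i = (A *ᵥ k) i := by
    rw [dotProduct_comm]
    exact congrArg (· ⬝ᵥ k) (funext fun j => hA.apply i j)
  simp only [toQuadraticForm'_apply_eq_dotProduct, mulVec_sub, mulVec_smul, mulVec_single_one,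
    sub_dotProduct, dotProduct_sub, smul_dotProduct, dotProduct_smul, single_one_dotProduct, hcol,
    col_apply, hi, smul_eq_mul]
  ring

theorem toQuadraticForm'_simpleReflection (hA : A.IsSymm) {i : ι} (hi : A i i = 2) (k : ι → ℤ) :
    A.toQuadraticForm' (simpleReflection A i k) = A.toQuadraticForm' k := by
  rw [simpleReflection, toQuadraticForm'_sub_smul_single hA hi]
  ring

theorem toQuadraticForm'_single (i : ι) : A.toQuadraticForm' (Pi.single i 1) = A i i := by
  simp [toQuadraticForm'_apply_eq_dotProduct]

theorem toQuadraticForm'_le_mul_mulVec_apply {k : ι → ℤ} (hk : 0 ≤ k) {i : ι}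
    (hle : ∀ j ≠ i, (A *ᵥ k) j ≤ 0) : A.toQuadraticForm' k ≤ k i * (A *ᵥ k) i := by
  rw [toQuadraticForm'_apply_eq_dotProduct, dotProduct,
    ← Finset.add_sum_erase _ _ (Finset.mem_univ i), add_le_iff_nonpos_right]
  exact Finset.sum_nonpos fun j hj =>
    mul_nonpos_of_nonneg_of_nonpos (hk j) (hle j (Finset.ne_of_mem_erase hj))

theorem IsRealRoot.toQuadraticForm'_eq_two (hA : A.IsSymm) (hdiag : ∀ i, A i i = 2) {k : ι → ℤ}
    (hk : IsRealRoot A k) : A.toQuadraticForm' k = 2 := by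
  induction hk with
  | simple i => rw [toQuadraticForm'_single, hdiag]
  | reflect i k _ ih => exact (toQuadraticForm'_simpleReflection hA (hdiag i) k).trans ih

end QuadraticForm

namespace Realization

variable {K : Type*} [Field K] [CharZero K] {ι : Type*} [Fintype ι] [DecidableEq ι]
  {A : Matrix ι ι ℤ} {H : Type*} [AddCommGroup H] [Module K H] {R : Realization K A H}

theorem natAbs_simpleReflection_lt {k : ι → ℤ} {i j : ι} (hi : A i i = 2) (hk : k ∈ R.roots)
    (hki : 0 < k i * (A *ᵥ k) i) (hji : j ≠ i) (hkj : k j ≠ 0) :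
    (simpleReflection A i k i).natAbs < (k i).natAbs := by
  have hsign {l : ι → ℤ} (hl : l ∈ R.roots) : 0 ≤ l i ∧ 0 ≤ l j ∨ l i ≤ 0 ∧ l j ≤ 0 :=
    (nonneg_or_nonpos_of_mem_roots hl).imp (fun h => ⟨h i, h j⟩) (fun h => ⟨h i, h j⟩)
  have hk' := hsign hk
  have hr' := hsign (simpleReflection_mem_roots hi hk)
  rw [simpleReflection_apply_of_ne A i k hji, simpleReflection_apply_self] at hr'
  rw [simpleReflection_apply_self]
  rcases pos_and_pos_or_neg_and_neg_of_mul_pos hki with h | h <;> omega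

theorem toQuadraticForm'_le_two_of_mem_roots (hA : A.IsSymm) (hdiag : ∀ i, A i i = 2) {k : ι → ℤ}
    (hk : k ∈ R.roots) : A.toQuadraticForm' k ≤ 2 := by
  induction hn : ∑ i, (k i).natAbs using Nat.strong_induction_on generalizing k with
  | _ n ih =>
  by_contra! hlt
  obtain ⟨i, -, hi⟩ : ∃ i ∈ Finset.univ, 0 < k i * (A *ᵥ k) i := by
    refine Finset.exists_lt_of_sum_lt (f := fun _ => 0) ?_
    rw [toQuadraticForm'_apply_eq_dotProduct] at hlt
    rw [Finset.sum_const_zero]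
    exact zero_lt_two.trans hlt
  obtain ⟨j, hji, hj⟩ : ∃ j ≠ i, k j ≠ 0 := by
    by_contra! h
    have hsingle : k = k i • Pi.single i 1 := by
      ext j
      obtain rfl | hj := eq_or_ne j i
      exacts [by simp, by simp [hj, h j hj]]
    have hsq := (sq_le_one_iff_abs_le_one (k i)).2 (abs_le_one_of_mem_roots hk h)
    rw [hsingle, QuadraticMap.map_smul, toQuadraticForm'_single, hdiag, smul_eq_mul] at hlt
    nlinarith
  have hlt' := natAbs_simpleReflection_lt (hdiag i) hk hi hji hj
  have hsum : ∑ l, (simpleReflection A i k l).natAbs < n := by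
    rw [← hn]
    refine Finset.sum_lt_sum (fun l _ => ?_) ⟨i, Finset.mem_univ i, hlt'⟩
    obtain rfl | hl := eq_or_ne l i
    exacts [hlt'.le, by rw [simpleReflection_apply_of_ne A i k hl]]
  have := ih _ hsum (simpleReflection_mem_roots (hdiag i) hk) rfl
  rw [toQuadraticForm'_simpleReflection hA (hdiag i)] at this
  exact this.not_gt hlt

theorem rootSpace_eq_bot_of_two_lt_toQuadraticForm' (hA : A.IsSymm) (hdiag : ∀ i, A i i = 2)
    {k : ι → ℤ} (hk : 2 < A.toQuadraticForm' k) : R.rootSpace k = ⊥ := by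
  by_contra hbot
  refine (toQuadraticForm'_le_two_of_mem_roots hA hdiag ⟨?_, hbot⟩).not_gt hk
  rintro rfl
  simp at hk

end Realization

/-! ### Simply laced affine Cartan matrices -/

section Semidefinite

variable {ι F : Type*} [Fintype ι] [Field F]

theorem two_mul_dotProduct_mulVec_eq_sum {A : Matrix ι ι F} (hA : A.IsSymm) {δ : ι → F}
    (hδ : ∀ i, δ i ≠ 0) (hAδ : A *ᵥ δ = 0) (k : ι → F) :
    2 * (k ⬝ᵥ A *ᵥ k) = ∑ i, ∑ j, -A i j * (δ i * δ j * (k i / δ i - k j / δ j) ^ 2) := by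
  have hrow : ∑ i, ∑ j, k i ^ 2 / δ i * (A i j * δ j) = 0 := by
    simp only [← Finset.mul_sum]
    exact Finset.sum_eq_zero fun i _ => mul_eq_zero_of_right _ (congrFun hAδ i)
  have hcol : ∑ i, ∑ j, k j ^ 2 / δ j * (A j i * δ i) = 0 := by rw [Finset.sum_comm, hrow]
  have hterm (i j : ι) : -A i j * (δ i * δ j * (k i / δ i - k j / δ j) ^ 2) =
      2 * (k i * (A i j * k j)) - k i ^ 2 / δ i * (A i j * δ j) -
        k j ^ 2 / δ j * (A j i * δ i) := by
    rw [hA.apply i j]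
    field [hδ i, hδ j]
  simp only [hterm, Finset.sum_sub_distrib, hrow, hcol, sub_zero, dotProduct, mulVec,
    Finset.mul_sum]

theorem dotProduct_mulVec_nonneg_of_mulVec_eq_zero [LinearOrder F] [IsStrictOrderedRing F]
    {A : Matrix ι ι F} (hA : A.IsSymm) (hoff : ∀ i j, i ≠ j → A i j ≤ 0) {δ : ι → F}
    (hδ : ∀ i, 0 < δ i) (hAδ : A *ᵥ δ = 0) (k : ι → F) : 0 ≤ k ⬝ᵥ A *ᵥ k := by
  refine nonneg_of_mul_nonneg_right ?_ (two_pos (α := F))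
  rw [two_mul_dotProduct_mulVec_eq_sum hA (fun i => (hδ i).ne') hAδ]
  refine Finset.sum_nonneg fun i _ => Finset.sum_nonneg fun j _ => ?_
  obtain rfl | hij := eq_or_ne i j
  · simp
  · have := neg_nonneg.2 (hoff i j hij)
    have := hδ i
    have := hδ j
    positivity

end Semidefinite

/-- A simply laced generalized Cartan matrix of affine type with null root `δ`: by the kernel
condition `δ` is primitive, and `A` is indecomposable. The type `A₁⁽¹⁾`, which has off-diagonal
entries `-2`, is not included. -/
structure IsSimplyLacedAffine {ι : Type*} [Fintype ι] (A : Matrix ι ι ℤ) (δ : ι → ℤ) : Prop where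
  isSymm : A.IsSymm
  diag : ∀ i, A i i = 2
  isSimplyLaced : A.IsSimplyLaced
  pos : ∀ i, 0 < δ i
  mulVec_eq_zero_iff : ∀ k, A *ᵥ k = 0 ↔ ∃ c : ℤ, k = c • δ

namespace IsSimplyLacedAffine

variable {ι : Type*} [Fintype ι] {A : Matrix ι ι ℤ} {δ : ι → ℤ}

theorem mulVec_delta (hA : IsSimplyLacedAffine A δ) : A *ᵥ δ = 0 :=
  (hA.mulVec_eq_zero_iff δ).2 ⟨1, (one_smul ℤ δ).symm⟩

theorem apply_nonpos (hA : IsSimplyLacedAffine A δ) {i j : ι} (hij : i ≠ j) : A i j ≤ 0 := by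
  rcases hA.isSimplyLaced hij with h | h <;> simp [h]

theorem ne_of_apply_eq_neg_one (hA : IsSimplyLacedAffine A δ) {i j : ι} (hij : A i j = -1) :
    i ≠ j := by
  rintro rfl
  simp [hA.diag] at hij

theorem exists_apply_eq_neg_one (hA : IsSimplyLacedAffine A δ) (i : ι) : ∃ j, A i j = -1 := by
  by_contra! h
  have hnonneg (j : ι) : 0 ≤ A i j := by
    obtain rfl | hij := eq_or_ne i j
    exacts [by simp [hA.diag], ((hA.isSimplyLaced hij).resolve_right (h j)).ge]
  refine (Finset.sum_pos' (fun j _ => mul_nonneg (hnonneg j) (hA.pos j).le)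
    ⟨i, Finset.mem_univ i, ?_⟩).ne' (congrFun hA.mulVec_delta i)
  simp [hA.diag, hA.pos]

variable [DecidableEq ι]

theorem toQuadraticForm'_nonneg (hA : IsSimplyLacedAffine A δ) (k : ι → ℤ) :
    0 ≤ A.toQuadraticForm' k := by
  let φ := Int.castRingHom ℚ
  have hker : A.map φ *ᵥ (φ ∘ δ) = 0 := by
    ext i
    rw [← RingHom.map_mulVec, hA.mulVec_delta, Pi.zero_apply, map_zero, Pi.zero_apply]
  have hnonneg : 0 ≤ (φ ∘ k) ⬝ᵥ A.map φ *ᵥ (φ ∘ k) :=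
    dotProduct_mulVec_nonneg_of_mulVec_eq_zero (hA.isSymm.map φ)
      (fun i j hij => Int.cast_nonpos.2 (hA.apply_nonpos hij))
      (fun i => Int.cast_pos.2 (hA.pos i)) hker (φ ∘ k)
  have hcast : ((k ⬝ᵥ A *ᵥ k : ℤ) : ℚ) = (φ ∘ k) ⬝ᵥ A.map φ *ᵥ (φ ∘ k) :=
    (RingHom.map_dotProduct φ _ _).trans
      (congrArg _ (funext fun i => RingHom.map_mulVec φ A k i))
  rwa [toQuadraticForm'_apply_eq_dotProduct, ← Int.cast_nonneg_iff (R := ℚ), hcast]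

theorem exists_eq_smul_of_toQuadraticForm'_eq_zero (hA : IsSimplyLacedAffine A δ) {k : ι → ℤ}
    (hk : A.toQuadraticForm' k = 0) : ∃ c : ℤ, k = c • δ := by
  refine (hA.mulVec_eq_zero_iff k).1 (funext fun i => ?_)
  have h := hA.toQuadraticForm'_nonneg ((2 : ℤ) • k - (A *ᵥ k) i • Pi.single i 1)
  rw [toQuadraticForm'_sub_smul_single hA.isSymm (hA.diag i), QuadraticMap.map_smul, hk,
    mulVec_smul, Pi.smul_apply, smul_eq_mul, smul_eq_mul, mul_zero] at h
  have : (A *ᵥ k) i ^ 2 ≤ 0 := by linarith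
  exact pow_eq_zero_iff two_ne_zero |>.1 (this.antisymm (sq_nonneg _))

theorem mulVec_apply_le_two (hA : IsSimplyLacedAffine A δ) {k : ι → ℤ}
    (hk : A.toQuadraticForm' k = 2) (i : ι) : (A *ᵥ k) i ≤ 2 := by
  have h := hA.toQuadraticForm'_nonneg (k - (1 : ℤ) • Pi.single i 1)
  rw [toQuadraticForm'_sub_smul_single hA.isSymm (hA.diag i)] at h
  linarith

theorem exists_eq_single_add_smul (hA : IsSimplyLacedAffine A δ) {k : ι → ℤ}
    (hk : A.toQuadraticForm' k = 2) {i : ι} (hi : (A *ᵥ k) i = 2) :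
    ∃ c : ℤ, k = Pi.single i 1 + c • δ := by
  obtain ⟨c, hc⟩ : ∃ c : ℤ, k - (1 : ℤ) • Pi.single i 1 = c • δ := by
    apply hA.exists_eq_smul_of_toQuadraticForm'_eq_zero
    rw [toQuadraticForm'_sub_smul_single hA.isSymm (hA.diag i), hk, hi]
    norm_num
  exact ⟨c, by rw [← hc, one_smul, add_sub_cancel]⟩

theorem mulVec_apply_le_one (hA : IsSimplyLacedAffine A δ) {k : ι → ℤ}
    (hk : A.toQuadraticForm' k = 2) {i : ι} (hi : ∀ c : ℤ, k ≠ Pi.single i 1 + c • δ) :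
    (A *ᵥ k) i ≤ 1 := by
  have hne : (A *ᵥ k) i ≠ 2 := fun h => (hA.exists_eq_single_add_smul hk h).elim hi
  have := hA.mulVec_apply_le_two hk i
  omega

end IsSimplyLacedAffine

namespace IsSimplyLacedAffine

variable {ι : Type*} [Fintype ι] [DecidableEq ι] {A : Matrix ι ι ℤ} {δ : ι → ℤ}

theorem toQuadraticForm'_delta_sub_single (hA : IsSimplyLacedAffine A δ) (i : ι) :
    A.toQuadraticForm' (δ - Pi.single i 1) = 2 := by
  have h := toQuadraticForm'_sub_smul_single hA.isSymm (hA.diag i) δ 1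
  rw [toQuadraticForm'_apply_eq_dotProduct δ, hA.mulVec_delta, dotProduct_zero, one_smul] at h
  simpa using h

theorem exists_simpleReflection_pos_or_eq (hA : IsSimplyLacedAffine A δ) {k : ι → ℤ}
    (hk : A.toQuadraticForm' k = 2) (hk0 : 0 ≤ k) {i : ι} (hki : 0 < k i) :
    (∃ j, 0 < (A *ᵥ k) j ∧ 0 < simpleReflection A j k i) ∨ k = Pi.single i 1 ∨
      k = Pi.single i 1 + δ := by
  rw [or_iff_not_imp_left]
  intro hrefl
  push Not at hrefl
  have hle (j : ι) (hji : j ≠ i) : (A *ᵥ k) j ≤ 0 := by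
    by_contra! h
    have := hrefl j h
    rw [simpleReflection_apply_of_ne A j k hji.symm] at this
    exact this.not_gt hki
  have hmul : 2 ≤ k i * (A *ᵥ k) i := hk ▸ toQuadraticForm'_le_mul_mulVec_apply hk0 hle
  have hpos : 0 < (A *ᵥ k) i := by
    by_contra! h
    exact absurd (mul_nonpos_of_nonneg_of_nonpos hki.le h) (by omega)
  have hki_le := hrefl i hpos
  rw [simpleReflection_apply_self] at hki_le
  have htwo : (A *ᵥ k) i = 2 := by
    obtain h | h : (A *ᵥ k) i = 1 ∨ (A *ᵥ k) i = 2 := by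
      have := hA.mulVec_apply_le_two hk i
      omega
    · rw [h] at hmul hki_le
      omega
    · exact h
  obtain ⟨c, rfl⟩ := hA.exists_eq_single_add_smul hk htwo
  have hδ := hA.pos i
  simp only [htwo, Pi.add_apply, Pi.single_eq_same, Pi.smul_apply, smul_eq_mul] at hki hki_le
  obtain rfl | rfl : c = 0 ∨ c = 1 := by
    have : 0 ≤ c := by by_contra! h; nlinarith
    have : c ≤ 1 := by by_contra! h; nlinarith
    omega
  · exact .inl (by simp)
  · exact .inr (by simp)

end IsSimplyLacedAffine

namespace Realization

variable {K : Type*} [Field K] [CharZero K] {ι : Type*} [Fintype ι] [DecidableEq ι]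
  {A : Matrix ι ι ℤ} {δ : ι → ℤ} {H : Type*} [AddCommGroup H] [Module K H] {R : Realization K A H}

theorem lie_f_lie_f_ne_zero (hA : IsSimplyLacedAffine A δ) {i j : ι} (hij : A i j = -1)
    {x : R.KacMoody} (hx : x ∈ R.rootSpace (Pi.single i 1 + δ)) (hx0 : x ≠ 0) :
    ⁅R.f j, ⁅R.f i, x⁆⁆ ≠ 0 := by
  have hji : A j i = -1 := (hA.isSymm.apply i j).trans hij
  have hex := lie_mem_rootSpace (R.e_mem_rootSpace j) hx
  have hex0 : ⁅R.e j, x⁆ ≠ 0 :=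
    lie_e_ne_zero (hA.diag j) hx hx0 (by simp [mulVec_add, hA.mulVec_delta, hji])
  have hfex0 : ⁅R.f i, ⁅R.e j, x⁆⁆ ≠ 0 :=
    lie_f_ne_zero (hA.diag i) hex hex0 (by simp [mulVec_add, hA.mulVec_delta, hij, hA.diag])
  have hefx : ⁅R.e j, ⁅R.f i, x⁆⁆ = ⁅R.f i, ⁅R.e j, x⁆⁆ := by
    rw [leibniz_lie, R.lie_e_f_ne (hA.ne_of_apply_eq_neg_one hji), zero_lie, zero_add]
  have hfx := lie_mem_rootSpace (R.f_mem_rootSpace i) hx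
  exact lie_f_ne_zero_of_lie_e_ne_zero (hA.diag j) hfx (by simp [hA.mulVec_delta]) (hefx ▸ hfex0)

theorem exists_inf_rootSpace_ne_bot_sum_lt (hA : IsSimplyLacedAffine A δ)
    {S : Submodule K R.KacMoody} (hS : ∀ j, ∀ x ∈ S, ⁅R.f j, x⁆ ∈ S) {k : ι → ℤ}
    (hk : A.toQuadraticForm' k = 2) (hk0 : 0 ≤ k) {i : ι} (hki : 0 < k i)
    (hSk : S ⊓ R.rootSpace k ≠ ⊥) (hne : k ≠ Pi.single i 1) :
    ∃ l : ι → ℤ, A.toQuadraticForm' l = 2 ∧ 0 < l i ∧ S ⊓ R.rootSpace l ≠ ⊥ ∧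
      ∑ j, l j < ∑ j, k j := by
  obtain ⟨x, ⟨hxS, hx⟩, hx0⟩ := Submodule.exists_mem_ne_zero_of_ne_bot hSk
  rcases hA.exists_simpleReflection_pos_or_eq hk hk0 hki with ⟨j, hj, hji⟩ | rfl | rfl
  · obtain ⟨m, hm⟩ := Int.eq_ofNat_of_zero_le hj.le
    refine ⟨_, (toQuadraticForm'_simpleReflection hA.isSymm (hA.diag j) k).trans hk, hji,
      (Submodule.ne_bot_iff _).2 ⟨_, ⟨Module.End.pow_apply_mem_of_forall_mem m (hS j) x hxS,
        ad_f_pow_mem_rootSpace_simpleReflection hx hm⟩, ad_f_pow_ne_zero (hA.diag j) hx hx0 hm⟩, ?_⟩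
    simpa [simpleReflection, ← Finset.mul_sum] using hj
  · exact absurd rfl hne
  · obtain ⟨j, hij⟩ := hA.exists_apply_eq_neg_one i
    have hy := lie_mem_rootSpace (R.f_mem_rootSpace j)
      (lie_mem_rootSpace (R.f_mem_rootSpace i) hx)
    rw [show -Pi.single j 1 + (-Pi.single i 1 + (Pi.single i 1 + δ)) = δ - Pi.single j 1 by
      abel] at hy
    refine ⟨_, hA.toQuadraticForm'_delta_sub_single j, ?_,
      (Submodule.ne_bot_iff _).2 ⟨_, ⟨hS j _ (hS i x hxS), hy⟩, lie_f_lie_f_ne_zero hA hij hx hx0⟩,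
      ?_⟩
    · simpa [hA.ne_of_apply_eq_neg_one hij] using hA.pos i
    · simp [Finset.sum_add_distrib]

theorem e_mem_of_inf_rootSpace_ne_bot (hA : IsSimplyLacedAffine A δ) {S : Submodule K R.KacMoody}
    (hS : ∀ j, ∀ x ∈ S, ⁅R.f j, x⁆ ∈ S) {k : ι → ℤ} (hk : A.toQuadraticForm' k = 2) {i : ι}
    (hki : 0 < k i) (hSk : S ⊓ R.rootSpace k ≠ ⊥) : R.e i ∈ S := by
  induction hn : (∑ j, k j).toNat using Nat.strong_induction_on generalizing k with
  | _ n ih =>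
  have hnonneg {l : ι → ℤ} (hli : 0 < l i) (hSl : S ⊓ R.rootSpace l ≠ ⊥) : 0 ≤ l := by
    have hl : l ∈ R.roots := ⟨fun h => by simp [h] at hli, ne_bot_of_le_ne_bot hSl inf_le_right⟩
    exact (nonneg_or_nonpos_of_mem_roots hl).resolve_right fun h => (h i).not_gt hli
  obtain rfl | hne := eq_or_ne k (Pi.single i 1)
  · obtain ⟨x, ⟨hxS, hx⟩, hx0⟩ := Submodule.exists_mem_ne_zero_of_ne_bot hSk
    obtain ⟨a, rfl⟩ := Submodule.mem_span_singleton.1 (R.rootSpace_single_le i hx)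
    exact (Submodule.smul_mem_iff _ (left_ne_zero_of_smul hx0)).1 hxS
  · obtain ⟨l, hl, hli, hSl, hlt⟩ :=
      exists_inf_rootSpace_ne_bot_sum_lt hA hS hk (hnonneg hki hSk) hki hSk hne
    refine ih _ ?_ hl hli hSl rfl
    have : 0 ≤ ∑ j, l j := Finset.sum_nonneg fun j _ => hnonneg hli hSl j
    omega

theorem lieSpan_insert_range_f_eq_derived (hA : IsSimplyLacedAffine A δ) {k : ι → ℤ}
    (hk : A.toQuadraticForm' k = 2) (hpos : ∀ i, 0 < k i) {x : R.KacMoody}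
    (hx : x ∈ R.rootSpace k) (hx0 : x ≠ 0) :
    LieSubalgebra.lieSpan K R.KacMoody (insert x (Set.range R.f)) = R.derived := by
  set S := LieSubalgebra.lieSpan K R.KacMoody (insert x (Set.range R.f))
  have hxS : x ∈ S := LieSubalgebra.subset_lieSpan (.inl rfl)
  have hfS (i : ι) : R.f i ∈ S := LieSubalgebra.subset_lieSpan (.inr ⟨i, rfl⟩)
  have heS (i : ι) : R.e i ∈ S :=
    e_mem_of_inf_rootSpace_ne_bot (S := S.toSubmodule) hA (fun j y hy => S.lie_mem (hfS j) hy) hk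
      (hpos i) ((Submodule.ne_bot_iff _).2 ⟨x, ⟨hxS, hx⟩, hx0⟩)
  have hk0 : k ≠ 0 := by
    rintro rfl
    simp at hk
  refine le_antisymm (LieSubalgebra.lieSpan_le.2 (insert_range_f_subset_derived hk0 hx))
    (R.derived_le_lieSpan.trans (LieSubalgebra.lieSpan_le.2 ?_))
  rintro _ (⟨i, rfl⟩ | ⟨i, rfl⟩)
  exacts [heS i, hfS i]

end Realization

namespace Realization

variable {K : Type*} [Field K] {ι : Type*} [Fintype ι] {A : Matrix ι ι ℤ}
  {H : Type*} [AddCommGroup H] [Module K H] {R : Realization K A H}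

theorem lie_f_lie_f_f (hA : A.IsSimplyLaced) (i j : ι) : ⁅R.f i, ⁅R.f i, R.f j⁆⁆ = 0 := by
  obtain rfl | hij := eq_or_ne i j
  · simp
  · have hle : (1 - A i j).toNat ≤ 2 := by rcases hA hij with h | h <;> simp [h]
    simpa [pow_two] using Module.End.pow_map_zero_of_le hle (R.serre_f hij)

variable [DecidableEq ι]

theorem lie_lie_eq_zero_of_mem_insert (hA : A.IsSimplyLaced) {γ : ι → ℤ} {x : R.KacMoody}
    (hx : x ∈ R.rootSpace γ) (hbot : ∀ i, R.rootSpace (2 • γ - Pi.single i 1) = ⊥)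
    (hbot' : ∀ i, R.rootSpace (γ - 2 • Pi.single i 1) = ⊥) :
    ∀ y ∈ insert x (Set.range R.f), ∀ z ∈ insert x (Set.range R.f), ⁅y, ⁅y, z⁆⁆ = 0 := by
  rintro _ (rfl | ⟨i, rfl⟩) _ (rfl | ⟨j, rfl⟩)
  · simp
  · refine (Submodule.eq_bot_iff _).1 (hbot j) _ ?_
    rw [show 2 • γ - Pi.single j 1 = γ + (γ + -Pi.single j 1) by module]
    exact lie_mem_rootSpace hx (lie_mem_rootSpace hx (R.f_mem_rootSpace j))
  · refine (Submodule.eq_bot_iff _).1 (hbot' i) _ ?_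
    rw [show γ - 2 • Pi.single i 1 = -Pi.single i 1 + (-Pi.single i 1 + γ) by module]
    exact lie_mem_rootSpace (R.f_mem_rootSpace i) (lie_mem_rootSpace (R.f_mem_rootSpace i) hx)
  · exact lie_f_lie_f_f hA i j

variable [CharZero K]

theorem rootSpace_two_smul_sub_single_eq_bot (hA : A.IsSymm) (hdiag : ∀ i, A i i = 2) {γ : ι → ℤ}
    (hγ : A.toQuadraticForm' γ = 2) {i : ι} (hle : (A *ᵥ γ) i ≤ 1) :
    R.rootSpace (2 • γ - Pi.single i 1) = ⊥ := by
  refine rootSpace_eq_bot_of_two_lt_toQuadraticForm' hA hdiag ?_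
  have h := toQuadraticForm'_sub_smul_single hA (hdiag i) ((2 : ℤ) • γ) 1
  rw [QuadraticMap.map_smul, mulVec_smul, Pi.smul_apply, hγ, one_smul, ofNat_zsmul] at h
  simp only [smul_eq_mul] at h
  omega

theorem rootSpace_sub_two_smul_single_eq_bot (hA : A.IsSymm) (hdiag : ∀ i, A i i = 2) {γ : ι → ℤ}
    (hγ : A.toQuadraticForm' γ = 2) {i : ι} (hle : (A *ᵥ γ) i ≤ 1) :
    R.rootSpace (γ - 2 • Pi.single i 1) = ⊥ := by
  refine rootSpace_eq_bot_of_two_lt_toQuadraticForm' hA hdiag ?_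
  have h := toQuadraticForm'_sub_smul_single hA (hdiag i) γ 2
  rw [hγ, ofNat_zsmul] at h
  omega

end Realization

/-! ### Homomorphisms from quantum minimal surface algebras -/

namespace QMSA

variable {K L : Type*} [CommRing K] [LieRing L] [LieAlgebra K L] {n m : ℕ} {μ : Fin n → K}

/-- The universal property of the quantum minimal surface algebra: a homomorphism is determined by
images of the generators that satisfy the defining relations. -/
noncomputable def lift (v : Fin n → L)
    (hv : ∀ j, ∑ i, qmsaSign n m i • ⁅v i, ⁅v i, v j⁆⁆ = μ j • v j) : QMSA K n m μ →ₗ⁅K⁆ L where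
  __ := (qmsaIdeal K n m μ).toSubmodule.liftQ
    (FreeLieAlgebra.lift K v : FreeLieAlgebra K (Fin n) →ₗ[K] L) (by
      refine LieSubmodule.lieSpan_le (N := (FreeLieAlgebra.lift K v).ker).2 ?_
      rintro _ ⟨j, rfl⟩
      simp [qmsaRelation, hv])
  map_lie' {x y} := by
    induction x using Submodule.Quotient.induction_on
    induction y using Submodule.Quotient.induction_on
    exact LieHom.map_lie (FreeLieAlgebra.lift K v) _ _

@[simp] theorem lift_gen (v : Fin n → L)
    (hv : ∀ j, ∑ i, qmsaSign n m i • ⁅v i, ⁅v i, v j⁆⁆ = μ j • v j) (j : Fin n) :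
    lift v hv (gen K n m μ j) = v j :=
  FreeLieAlgebra.lift_of_apply v j

theorem exists_lieHom_snoc {r : ℕ} (m : ℕ) {S : LieSubalgebra K L} {f : Fin r → L} {x : L}
    (hS : insert x (Set.range f) ⊆ (S : Set L))
    (hlie : ∀ y ∈ insert x (Set.range f), ∀ z ∈ insert x (Set.range f), ⁅y, ⁅y, z⁆⁆ = 0) :
    ∃ φ : QMSA K (r + 1) m 0 →ₗ⁅K⁆ S,
      (∀ i : Fin r, (φ (gen K (r + 1) m 0 i.castSucc) : L) = f i) ∧
      (φ (gen K (r + 1) m 0 (Fin.last r)) : L) = x ∧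
      (LieSubalgebra.lieSpan K L (insert x (Set.range f)) = S → Function.Surjective φ) := by
  have hmem (j : Fin (r + 1)) : Fin.snoc (α := fun _ => L) f x j ∈ insert x (Set.range f) :=
    Fin.range_snoc f x ▸ Set.mem_range_self j
  let v (j : Fin (r + 1)) : S := ⟨Fin.snoc (α := fun _ => L) f x j, hS (hmem j)⟩
  have hv (i j : Fin (r + 1)) : ⁅v i, ⁅v i, v j⁆⁆ = 0 := Subtype.ext (hlie _ (hmem i) _ (hmem j))
  let φ : QMSA K (r + 1) m 0 →ₗ⁅K⁆ S := lift v (by simp [hv])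
  have hf (i : Fin r) : (φ (gen K (r + 1) m 0 i.castSucc) : L) = f i := by simp [φ, v]
  have hx : (φ (gen K (r + 1) m 0 (Fin.last r)) : L) = x := by simp [φ, v]
  refine ⟨φ, hf, hx, fun hspan y => ?_⟩
  have hle : S ≤ (S.incl.comp φ).range := by
    refine hspan.ge.trans (LieSubalgebra.lieSpan_le.2 ?_)
    rintro _ (rfl | ⟨i, rfl⟩)
    exacts [⟨_, hx⟩, ⟨_, hf i⟩]
  obtain ⟨z, hz⟩ := hle y.2
  exact ⟨z, Subtype.ext hz⟩

end QMSA

theorem mainTheorem5_general {K : Type*} [Field K] [CharZero K] {r : ℕ}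
    {A : Matrix (Fin r) (Fin r) ℤ} {δ : Fin r → ℤ} (hA : IsSimplyLacedAffine A δ)
    {H : Type*} [AddCommGroup H] [Module K H] (R : Realization K A H) {γ : Fin r → ℤ}
    (hγ : IsRealRoot A γ) (hγα : ∀ i (c : ℤ), γ ≠ Pi.single i 1 + c • δ)
    {e : R.KacMoody} (he : e ∈ R.rootSpace γ) (he0 : e ≠ 0) :
    (∀ i, 2 • γ - Pi.single i 1 ∉ R.roots ∧ γ - 2 • Pi.single i 1 ∉ R.roots) ∧
    (∀ y ∈ insert e (Set.range R.f), ∀ z ∈ insert e (Set.range R.f), ⁅y, ⁅y, z⁆⁆ = 0) ∧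
    ((∀ i, 0 < γ i) →
      LieSubalgebra.lieSpan K R.KacMoody (insert e (Set.range R.f)) = R.derived) ∧
    (∀ d : ℕ, d ≤ r + 1 → ∃ φ : QMSA K (r + 1) d 0 →ₗ⁅K⁆ R.derived,
      (∀ i : Fin r, (φ (QMSA.gen K (r + 1) d 0 i.castSucc) : R.KacMoody) = R.f i) ∧
      (φ (QMSA.gen K (r + 1) d 0 (Fin.last r)) : R.KacMoody) = e ∧
      ((∀ i, 0 < γ i) → Function.Surjective φ)) := by
  have hq : A.toQuadraticForm' γ = 2 := hγ.toQuadraticForm'_eq_two hA.isSymm hA.diag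
  have hle (i : Fin r) : (A *ᵥ γ) i ≤ 1 := hA.mulVec_apply_le_one hq (hγα i)
  have hbot (i : Fin r) : R.rootSpace (2 • γ - Pi.single i 1) = ⊥ :=
    Realization.rootSpace_two_smul_sub_single_eq_bot hA.isSymm hA.diag hq (hle i)
  have hbot' (i : Fin r) : R.rootSpace (γ - 2 • Pi.single i 1) = ⊥ :=
    Realization.rootSpace_sub_two_smul_single_eq_bot hA.isSymm hA.diag hq (hle i)
  have hlie := Realization.lie_lie_eq_zero_of_mem_insert hA.isSimplyLaced he hbot hbot'
  have hspan (hpos : ∀ i, 0 < γ i) :=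
    Realization.lieSpan_insert_range_f_eq_derived hA hq hpos he he0
  refine ⟨fun i => ⟨fun h => h.2 (hbot i), fun h => h.2 (hbot' i)⟩, hlie, hspan, fun d _ => ?_⟩
  have hγ0 : γ ≠ 0 := by
    rintro rfl
    simp at hq
  obtain ⟨φ, hφf, hφe, hφ⟩ :=
    QMSA.exists_lieHom_snoc d (Realization.insert_range_f_subset_derived hγ0 he) hlie
  exact ⟨φ, hφf, hφe, fun hpos => hφ (hspan hpos)⟩

theorem isSimplyLacedAffine_cartanE9 : IsSimplyLacedAffine cartanE9 deltaE9 where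
  isSymm := by decide
  diag := by decide
  isSimplyLaced := by decide
  pos := by decide
  mulVec_eq_zero_iff k := by
    constructor
    · intro h
      refine ⟨k 0, ?_⟩
      have hδ : deltaE9 = ![1, 2, 3, 4, 6, 5, 4, 3, 2] := by decide
      simp only [cartanE9, hδ, cons_mulVec, empty_mulVec, smul_cons, smul_empty, dotProduct,
        Fin.sum_univ_succ, Fin.forall_fin_succ, funext_iff, cons_val_zero, cons_val_succ,
        cons_val_fin_one, Fin.succ_zero_eq_one, Fin.succ_one_eq_two, Fin.reduceSucc,
        Finset.univ_unique, Fin.default_eq_zero, Finset.sum_singleton, Pi.zero_apply, smul_eq_mul,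
        IsEmpty.forall_iff, and_true] at h ⊢
      omega
    · rintro ⟨c, rfl⟩
      rw [mulVec_smul, show cartanE9 *ᵥ deltaE9 = 0 by decide, smul_zero]

theorem ne_single_add_smul_deltaE9 {n : ℤ} {β : Fin 8 → ℤ} (hβθ : β ≠ -thetaE8)
    (hβα : ∀ i : Fin 8, β ≠ Pi.single i 1) (i : Fin 9) (c : ℤ) :
    n • deltaE9 + embedE8 β ≠ Pi.single i 1 + c • deltaE9 := by
  intro h
  have hzero := congrFun h 0
  have hsucc (j : Fin 8) := congrFun h j.succ
  simp only [deltaE9, embedE8, Pi.add_apply, Pi.smul_apply, Pi.single_eq_same, Fin.cons_zero,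
    Fin.cons_succ, smul_eq_mul, add_zero, mul_one, Pi.single_eq_of_ne (Fin.succ_ne_zero _),
    zero_add] at hzero hsucc
  cases i using Fin.cases with
  | zero =>
    refine hβθ (funext fun j => ?_)
    have := hsucc j
    rw [Pi.single_eq_same] at hzero
    rw [hzero, Pi.single_eq_of_ne (Fin.succ_ne_zero _)] at this
    rw [Pi.neg_apply]
    linarith
  | succ l =>
    refine hβα l (funext fun j => ?_)
    have := hsucc j
    rw [Pi.single_eq_of_ne (Fin.succ_ne_zero _).symm, zero_add] at hzero
    simp only [hzero, Pi.single_apply, Fin.succ_inj] at this ⊢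
    linarith

theorem mainTheorem5 {K : Type*} [RCLike K]
    {H₈ : Type*} [AddCommGroup H₈] [Module K H₈] (R₈ : Realization K CartanMatrix.E₈ H₈)
    {H₉ : Type*} [AddCommGroup H₉] [Module K H₉] (R₉ : Realization K cartanE9 H₉)
    (n : ℤ) (β : Fin 8 → ℤ) (γ : Fin 9 → ℤ)
    (hβ : β ∈ R₈.roots) (hβθ : β ≠ -thetaE8) (hβα : ∀ i : Fin 8, β ≠ Pi.single i 1)
    (hγ : γ = n • deltaE9 + embedE8 β) (hγre : IsRealRoot cartanE9 γ)
    (e : R₉.KacMoody) (he : e ∈ R₉.rootSpace γ) (he0 : e ≠ 0) :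
    -- the relevant weights are not roots
    (∀ i : Fin 9, 2 • γ - Pi.single i 1 ∉ R₉.roots ∧ γ - 2 • Pi.single i 1 ∉ R₉.roots) ∧
    -- double brackets vanish
    (∀ y ∈ insert e (Set.range R₉.f), ∀ z ∈ insert e (Set.range R₉.f), ⁅y, ⁅y, z⁆⁆ = 0) ∧
    -- generation of the derived algebra, for a positive root of maximal support
    ((∀ i, 0 < γ i) →
      LieSubalgebra.lieSpan K R₉.KacMoody (insert e (Set.range R₉.f)) = R₉.derived) ∧
    -- the homomorphism, which is an epimorphism for a positive root of maximal support
    (∀ d : ℕ, d ≤ 10 → ∃ φ : QMSA K 10 d 0 →ₗ⁅K⁆ R₉.derived,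
      (∀ i : Fin 9, (φ (QMSA.gen K 10 d 0 i.castSucc) : R₉.KacMoody) = R₉.f i) ∧
      (φ (QMSA.gen K 10 d 0 (Fin.last 9)) : R₉.KacMoody) = e ∧
      ((∀ i, 0 < γ i) → Function.Surjective φ)) := by
  subst hγ
  exact mainTheorem5_general isSimplyLacedAffine_cartanE9 R₉ hγre
    (ne_single_add_smul_deltaE9 hβθ hβα) he he0
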